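/- **Setting.** Let $d\ge 1$, let $\mathcal A$ be a finite alphabet, $\Omega=\mathcal A^{\mathbb Z^d}$ with the product $\sigma$-algebra $\mathcal F$, $X_i(\omega)=\omega(i)$, $\mathcal F_S=\sigma(X_i:i\in S)$, and let $\|\cdot\|$ be the maximum norm on $\mathbb Z^d$. A *specification* is a family $\gamma=(\gamma_\Lambda)$ of probability kernels on $(\Omega,\mathcal F)$, indexed by the finite sets $\Lambda\subset\mathbb Z^d$, such that $\gamma_\Lambda(E|\cdot)$ is $\mathcal F_{\Lambda^c}$-measurable for $E\in\mathcal F$, $\gamma_\Lambda(E|\omega)=1_E(\omega)$ for $E\in\mathcal F_{\Lambda^c}$, and $\int\gamma_\Delta(d\omega'|\omega)\gamma_\Lambda(E|\omega')=\gamma_\Delta(E|\omega)$ for $\Lambda\subset\Delta$. For $\Gamma\subset\mathbb Z^d$ we say that $\gamma_\Lambda(\cdot|\omega)=\gamma_\Lambda(\cdot|\omega_\Gamma)$ if the law of $X_\Lambda$ under $\gamma_\Lambda(\cdot|\omega')$ is the same for all $\omega'$ that agree with $\omega$ on $\Gamma$. A probability measure $\mu$ on $\Omega$ is a *variable-neighborhood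 random field* with specification $\gamma$ if $\int\mu(d\omega)\gamma_\Lambda(E|\omega)=\mu(E)$ for all finite $\Lambda$ and all $E\in\mathcal F$, and if for every finite $\Lambda$ and $\mu$-almost every $\omega$ there is a least set $\Gamma$ with $\gamma_\Lambda(\cdot|\omega)=\gamma_\Lambda(\cdot|\omega_\Gamma)$ and it is finite; this set is denoted by $\mathrm{sp}_\Lambda(\omega)$. It is *translation covariant* if $\gamma_\Lambda(\cdot|T_i\omega)$ is the image of $\gamma_{\Lambda+i}(\cdot|\omega)$ under $T_i$ for all $i,\Lambda,\omega$, where $(T_i\omega)(j)=\omega(i+j)$. Put $q_{\min}=\inf_{a}\inf_{\omega}\gamma_{\{0\}}(X_0=a|\omega)$. Let $V_i(r)=\{j:\|i-j\|\le r\}$, $V_0^0(\ell)=V_0(\ell)\setminus\{0\}$, $\partial V_0(\ell)=\{j:\|j\|=\ell\}$, and let $l_i(\omega)=\inf\{\ell\in\mathbb N:\ell>0,\ \mathrm{sp}_{\{i\}}(\omega)\subset V_i(\ell)\}$ be the length of the context of $i$. **Estimator.** Let $(\Lambda_n)$ be an increasing sequence of finite subsets of $\mathbb Z^d$ such that every finite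 set is contained in some $\Lambda_n$. Let $\bar\Lambda_n=\{i\in\Lambda_n: V_i(k(n))\subset\Lambda_n\}$ with $k(n)=(\log|\Lambda_n|)^{1/(2d)}$, and $R_n=\lfloor(\log|\bar\Lambda_n|)^{1/(2d)}\rfloor$. Write $\sigma_i^\ell=(\sigma(i+j))_{j\in V^0_0(\ell)}$ and, for $\eta\in\mathcal A^{V_0^0(\ell)}$ and $a\in\mathcal A$, $N_n(\eta)=|\{j\in\bar\Lambda_n:\sigma_j^\ell=\eta\}|$, $N_n(\eta,a)=|\{j\in\bar\Lambda_n:\sigma_j^\ell=\eta,\ \sigma(j)=a\}|$, and $\hat p_n(a|\eta)=N_n(\eta,a)/N_n(\eta)$ ($=0$ if $N_n(\eta)=0$). Let $$\log L_n(i,\ell)=\sum_{\eta}N_n(\eta)\sum_{a\in\mathcal A}\hat p_n(a|\eta)\log\frac{\hat p_n(a|\eta)}{\hat p_n(a|\sigma_i^{\ell-1})},$$ where $\eta$ runs over the configurations in $\mathcal A^{V_0^0(\ell)}$ that extend $\sigma_i^{\ell-1}$ (and $0\log0=0$), and $$\mathrm{pen}(\ell,n)=\kappa(\delta)\,|\mathcal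 A|\,|\mathcal A|^{|\partial V_0(\ell)|}\log|\Lambda_n|,\qquad \kappa(\delta)=5^d\left(\tfrac32\right)^{1/2}\delta .$$ The estimator $\hat l_n(i)$ is the least $\ell\in\{1,\dots,R_n-1\}$ such that $\log L_n(i,k)\le\mathrm{pen}(k,n)$ for all $\ell<k\le R_n$; if there is no such $\ell$, then $\hat l_n(i)=R_n$. **Theorem (Overestimation).** For every $d\ge1$ there is a constant $C(d)>0$, depending only on $d$, with the following property. Fix $\mathcal A$ and $(\Lambda_n)$ as above, and let $q>0$, $\epsilon>0$ and $$\delta>2^d\log|\mathcal A|\,\frac{3e}{4q}.$$ Then $$c(\delta)=\frac23\cdot\frac{2q\delta}{e}-2^d\log|\mathcal A|>0,$$ and there is an $n_0$ such that for every translation covariant variable-neighborhood random field $\mu$ on $\mathcal A^{\mathbb Z^d}$ whose specification is positive with $q_{\min}=q$, and for all $n\ge n_0$, $$\mu\left[\exists\, i\in\bar\Lambda_n:\hat l_n(i)>l_i(\sigma)\right]\le C(d)\,(\log|\bar\Lambda_n|)^{\frac{d+1}{2d}}\exp\left(-c(\delta)\sqrt{\log|\bar\Lambda_n|}\right)+C(d)\exp\left(-|\bar\Lambda_n|^{1-\epsilon}\right).$$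 -/

import Mathlib

open MeasureTheory ProbabilityTheory

namespace VNRF

noncomputable section

/-- The lattice `ℤ^d`. Its norm in Mathlib (the sup norm of a pi type) is the maximum norm. -/
abbrev Site (d : ℕ) : Type := Fin d → ℤ

/-- Configurations `Ω = A^(ℤ^d)`, with the product σ-algebra. -/
abbrev Config (d : ℕ) (A : Type*) : Type _ := Site d → A

/-! ### Specifications and random fields -/

section Fields

variable {d : ℕ} {A : Type*} [MeasurableSpace A]

/-- A specification: a family of probability kernels indexed by the finite subsets of `ℤ^d`.
`cylinderEvents S` is the σ-algebra generated by the coordinates `X_i`, `i ∈ S`. -/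
structure IsSpecification (γ : Finset (Site d) → Kernel (Config d A) (Config d A)) : Prop where
  isMarkov : ∀ Λ, IsMarkovKernel (γ Λ)
  measurable_compl : ∀ (Λ : Finset (Site d)) (E : Set (Config d A)), MeasurableSet E →
    Measurable[cylinderEvents ((Λ : Set (Site d))ᶜ)] (fun ω => γ Λ ω E)
  proper : ∀ (Λ : Finset (Site d)) (E : Set (Config d A)),
    MeasurableSet[cylinderEvents ((Λ : Set (Site d))ᶜ)] E →
      ∀ ω, γ Λ ω E = E.indicator 1 ω
  consistent : ∀ (Λ Δ : Finset (Site d)), Λ ⊆ Δ → ∀ E : Set (Config d A), MeasurableSet E →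
    ∀ ω, ∫⁻ ω', γ Λ ω' E ∂(γ Δ ω) = γ Δ ω E

/-- The measure `μ` is consistent with the specification `γ`. -/
def IsConsistent (μ : Measure (Config d A))
    (γ : Finset (Site d) → Kernel (Config d A) (Config d A)) : Prop :=
  ∀ (Λ : Finset (Site d)) (E : Set (Config d A)), MeasurableSet E →
    ∫⁻ ω, γ Λ ω E ∂μ = μ E

/-- `γ_Λ(· | ω) = γ_Λ(· | ω_Γ)`: the law `γ_Λ(· | ω)` of the symbols in `Λ` depends on `ω` only
through its restriction to `Γ`, i.e. it is the same for every `ω'` that agrees with `ω` on `Γ`. -/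
def Determines (γ : Finset (Site d) → Kernel (Config d A) (Config d A))
    (Λ : Finset (Site d)) (ω : Config d A) (Γ : Set (Site d)) : Prop :=
  ∀ ω' : Config d A, (∀ j ∈ Γ, ω' j = ω j) →
    ∀ ζ : Config d A, γ Λ ω' {ξ | ∀ j ∈ Λ, ξ j = ζ j} = γ Λ ω {ξ | ∀ j ∈ Λ, ξ j = ζ j}

/-- `μ` is a variable-neighborhood random field with specification `γ`: it is consistent with `γ`
and, for every finite `Λ` and almost every `ω`, among all sets `Γ` with
`γ_Λ(· | ω) = γ_Λ(· | ω_Γ)` there is a least one, and it is finite. -/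
structure IsVariableNeighborhood (μ : Measure (Config d A))
    (γ : Finset (Site d) → Kernel (Config d A) (Config d A)) : Prop where
  isSpecification : IsSpecification γ
  isConsistent : IsConsistent μ γ
  exists_support : ∀ Λ : Finset (Site d), ∀ᵐ ω ∂μ,
    ∃ Γ : Set (Site d), Γ.Finite ∧ IsLeast {Γ' | Determines γ Λ ω Γ'} Γ

/-- The support of the context `sp_Λ(ω)`. -/
def ctxSupport (γ : Finset (Site d) → Kernel (Config d A) (Config d A))
    (Λ : Finset (Site d)) (ω : Config d A) : Set (Site d) :=
  ⋂₀ {Γ | Determines γ Λ ω Γ}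

/-- Whenever a least determining set exists, `ctxSupport` is that set. -/
theorem ctxSupport_eq_of_isLeast {γ : Finset (Site d) → Kernel (Config d A) (Config d A)}
    {Λ : Finset (Site d)} {ω : Config d A} {Γ : Set (Site d)}
    (h : IsLeast {Γ' | Determines γ Λ ω Γ'} Γ) : ctxSupport γ Λ ω = Γ :=
  Set.Subset.antisymm (Set.sInter_subset_of_mem h.1) (Set.subset_sInter fun _ hΓ' => h.2 hΓ')

/-- The `i`-shift `(T_i ω)(j) = ω(i + j)`. -/
def shift (i : Site d) (ω : Config d A) : Config d A := fun j => ω (i + j)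

/-- Translation covariance of the specification: the site `j` of `T_i ω` is the site `i + j` of
`ω`, so `γ_Λ(· | T_i ω)` is the image under `T_i` of `γ_(Λ + i)(· | ω)`. -/
def IsTranslationCovariant (γ : Finset (Site d) → Kernel (Config d A) (Config d A)) : Prop :=
  ∀ (i : Site d) (Λ : Finset (Site d)) (ω : Config d A),
    γ Λ (shift i ω) = (γ (Λ.map (addLeftEmbedding i)) ω).map (shift i)

/-- `q_min = inf_a inf_ω γ_0(a | ω)`. -/
def qMin (γ : Finset (Site d) → Kernel (Config d A) (Config d A)) : ℝ :=
  ⨅ a : A, ⨅ ω : Config d A, (γ {0} ω).real {ξ | ξ 0 = a}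

end Fields

/-! ### Boxes, context length -/

section Boxes

variable {d : ℕ}

/-- The box `V_i(ℓ)`. -/
def box (i : Site d) (ℓ : ℕ) : Finset (Site d) :=
  Finset.Icc (i - fun _ => (ℓ : ℤ)) (i + fun _ => (ℓ : ℤ))

theorem mem_box {i j : Site d} {ℓ : ℕ} : j ∈ box i ℓ ↔ ‖i - j‖ ≤ ℓ := by
  rw [box, Finset.mem_Icc, pi_norm_le_iff_of_nonneg (Nat.cast_nonneg ℓ), Pi.le_def, Pi.le_def,
    ← forall_and]
  refine forall_congr' fun m => ?_
  have h : ‖(i - j) m‖ ≤ (ℓ : ℝ) ↔ |i m - j m| ≤ (ℓ : ℤ) := by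
    rw [Int.norm_eq_abs, Pi.sub_apply]
    exact_mod_cast Iff.rfl
  rw [h, abs_le]
  simp only [Pi.sub_apply, Pi.add_apply]
  constructor <;> rintro ⟨h1, h2⟩ <;> constructor <;> linarith

/-- The punctured box `V_0^0(ℓ)`. -/
def pbox (d ℓ : ℕ) : Finset (Site d) := (box 0 ℓ).erase 0

theorem pbox_mono {m ℓ : ℕ} (h : m ≤ ℓ) : pbox d m ⊆ pbox d ℓ := by
  refine Finset.erase_subset_erase _ fun j hj => ?_
  rw [mem_box] at hj ⊢
  exact hj.trans (by exact_mod_cast h)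

open Classical in
/-- The sphere `∂V_0(ℓ)`. -/
def sphere (d ℓ : ℕ) : Finset (Site d) := (box 0 ℓ).filter fun j => ‖j‖ = ℓ

/-- The length of the context of the site `i`,
`l_i(ω) = inf {ℓ > 0 : sp_i(ω) ⊆ V_i(ℓ)}` (it is `⊤` if there is no such `ℓ`). -/
def ctxLength {A : Type*} [MeasurableSpace A]
    (γ : Finset (Site d) → Kernel (Config d A) (Config d A)) (i : Site d) (ω : Config d A) : ℕ∞ :=
  sInf {x : ℕ∞ | ∃ ℓ : ℕ, x = ℓ ∧ 0 < ℓ ∧ ctxSupport γ {i} ω ⊆ (box i ℓ : Set (Site d))}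

/-- An increasing and absorbing sequence of finite observation regions. -/
structure IsSampling (Λ : ℕ → Finset (Site d)) : Prop where
  mono : ∀ n, Λ n ⊆ Λ (n + 1)
  absorbing : ∀ Λ' : Finset (Site d), ∃ n, Λ' ⊆ Λ n

/-- `k(n) = (log |Λ_n|)^(1/(2d))`, for the observation region `Λ = Λ_n`. -/
def kRadius (Λ : Finset (Site d)) : ℝ := (Real.log (Λ.card : ℝ)) ^ (1 / (2 * (d : ℝ)))

open Classical in
/-- The security region `{i ∈ Λ_n : V_i(k(n)) ⊆ Λ_n}`, for the observation region `Λ = Λ_n`. -/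
def security (Λ : Finset (Site d)) : Finset (Site d) :=
  Λ.filter fun i => ∀ j : Site d, ‖i - j‖ ≤ kRadius Λ → j ∈ Λ

/-- The security diameter `R_n`, the integer part of `(log |security region|)^(1/(2d))`. -/
def secDiam (Λ : Finset (Site d)) : ℕ :=
  ⌊(Real.log ((security Λ).card : ℝ)) ^ (1 / (2 * (d : ℝ)))⌋₊

end Boxes

/-! ### The estimator. Here `Λ` is the observation region and `σ` the observed configuration. -/

section Estimator

variable {d : ℕ} {A : Type*}

/-- Patterns `A^(V_0^0(ℓ))`. -/
abbrev Pattern (d : ℕ) (A : Type*) (ℓ : ℕ) : Type _ := (pbox d ℓ) → A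

/-- `σ_i^ℓ = X_i^ℓ(σ)`: the pattern of radius `ℓ` around `i`, without the center. -/
def window (ℓ : ℕ) (i : Site d) (σ : Config d A) : Pattern d A ℓ :=
  fun j => σ (i + (j : Site d))

/-- The restriction of a pattern of radius `ℓ` to the radius `ℓ - 1`. -/
def truncate {ℓ : ℕ} (η : Pattern d A ℓ) : Pattern d A (ℓ - 1) :=
  fun j => η ⟨j, pbox_mono (Nat.sub_le ℓ 1) j.2⟩

open Classical in
/-- `N_n(η)`. -/
def count (Λ : Finset (Site d)) (σ : Config d A) {ℓ : ℕ} (η : Pattern d A ℓ) : ℕ :=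
  ((security Λ).filter fun j => window ℓ j σ = η).card

open Classical in
/-- `N_n(η, a)`. -/
def countSym (Λ : Finset (Site d)) (σ : Config d A) {ℓ : ℕ} (η : Pattern d A ℓ) (a : A) : ℕ :=
  ((security Λ).filter fun j => window ℓ j σ = η ∧ σ j = a).card

/-- `p̂_n(a | η) = N_n(η, a) / N_n(η)`, and `0` if `N_n(η) = 0`. -/
def pHat (Λ : Finset (Site d)) (σ : Config d A) {ℓ : ℕ} (η : Pattern d A ℓ) (a : A) : ℝ :=
  (countSym Λ σ η a : ℝ) / (count Λ σ η : ℝ)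

variable [Fintype A]

/-- Kullback-Leibler information `∑_a p(a) log (p(a) / q(a))`, with `0 log 0 = 0`. -/
def klInfo (p q : A → ℝ) : ℝ := ∑ a, p a * Real.log (p a / q a)

open Classical in
/-- `log L_n(i, ℓ)`: the sum, over all extensions `η` of `σ_i^(ℓ-1)` to a pattern of radius `ℓ`,
of `N_n(η) D(p̂_n(· | η), p̂_n(· | σ_i^(ℓ-1)))`. It is used for `ℓ ≥ 2` only. -/
def logL (Λ : Finset (Site d)) (σ : Config d A) (i : Site d) (ℓ : ℕ) : ℝ :=
  ∑ η ∈ (Finset.univ : Finset (Pattern d A ℓ)).filter (fun η => truncate η = window (ℓ - 1) i σ),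
    (count Λ σ η : ℝ) * klInfo (pHat Λ σ η) (pHat Λ σ (window (ℓ - 1) i σ))

/-- `κ(δ) = 5^d (3/2)^(1/2) δ`. -/
def kappa (d : ℕ) (δ : ℝ) : ℝ := 5 ^ d * Real.sqrt (3 / 2) * δ

/-- The penalty `pen(ℓ, n) = κ(δ) |A| |A|^|∂V_0(ℓ)| log |Λ_n|`. -/
def pen (A : Type*) [Fintype A] (δ : ℝ) (Λ : Finset (Site d)) (ℓ : ℕ) : ℝ :=
  kappa d δ * (Fintype.card A : ℝ) * (Fintype.card A : ℝ) ^ (sphere d ℓ).card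
    * Real.log (Λ.card : ℝ)

open Classical in
/-- The admissible `ℓ ∈ {1, …, R_n - 1}`: those with `log L_n(i, k) ≤ pen(k, n)` for all
`ℓ < k ≤ R_n`. -/
def admissible (δ : ℝ) (Λ : Finset (Site d)) (σ : Config d A) (i : Site d) : Finset ℕ :=
  (Finset.Icc 1 (secDiam Λ - 1)).filter fun ℓ =>
    ∀ k, ℓ < k → k ≤ secDiam Λ → logL Λ σ i k ≤ pen A δ Λ k

open Classical in
/-- The estimator `l̂_n(i)`: the least admissible `ℓ`, and `R_n` if there is none. -/
def lHat (δ : ℝ) (Λ : Finset (Site d)) (σ : Config d A) (i : Site d) : ℕ :=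
  if h : (admissible δ Λ σ i).Nonempty then (admissible δ Λ σ i).min' h else secDiam Λ

/-- `c(δ) = (2/3) (2 q_min δ / e) - 2^d log |A|`. -/
def cDelta (d : ℕ) (A : Type*) [Fintype A] (δ q : ℝ) : ℝ :=
  2 / 3 * (2 * q * δ / Real.exp 1) - 2 ^ d * Real.log (Fintype.card A : ℝ)

end Estimator

end

end VNRF

/-! Suppose the estimate at `i` exceeds the context length `ℓ`. Then some radius `k` with `ℓ < k ≤
R_n` violates the penalty bound. As the context of `i` lies within radius `k - 1`, every extension
`ζ` of the observed pattern of radius `k - 1` has the same one-site law `p`. The log-likelihood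
ratio is at most the chi-square distance of the empirical counts from `p` (`sum_mul_klInfo_le`), so
exceeding the penalty forces `(N(ζ,a) - p(a) N(ζ))² > p(a) κ(δ) log|Λ_n| N(ζ)` for some `ζ` and `a`
(`logL_le_pen`, `exists_mem_largeDeviation`).

This event has small probability by a self-normalized Hoeffding bound. Sites in one residue class
modulo `k + 1` lie outside each other's windows, so resampling one of them changes neither the
occurrences of `ζ` in that class nor the other symbols there. An exponential product over the class
can thus be integrated out one site at a time (`IsConsistent.lintegral_prod_le_one`), even with a
tilt depending on the random number of occurrences (`IsConsistent.measure_deviation_le`). No lower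
bound on `N(ζ)` is needed. Cauchy–Schwarz recombines the `(k + 1)^d` classes.

The events are indexed by patterns, not by sites, so the union bound over `i` costs nothing. Since
`k^d ≤ R_n^d ≤ √(log|security region|)`, both the log-number of patterns and the deviation exponent
are of order this square root, and the size of `δ` makes the latter win (`sum_union_bound_le`). -/

namespace VNRF

/-! ### One-site conditional laws and integration site by site. -/

section Specification

variable {d : ℕ} {A : Type*} [MeasurableSpace A]
  {γ : Finset (Site d) → Kernel (Config d A) (Config d A)}

/-- A function that is measurable with respect to the coordinates in `S` depends only on them. -/
theorem eq_of_measurable_cylinderEvents {S : Set (Site d)} {f : Config d A → ENNReal}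
    (hf : Measurable[cylinderEvents S] f) {ω ω' : Config d A} (h : ∀ i ∈ S, ω i = ω' i) :
    f ω = f ω' := by
  have hle : cylinderEvents (X := fun _ : Site d => A) S ≤
      MeasurableSpace.comap (fun (ω : Config d A) (i : S) => ω i) inferInstance := by
    refine iSup₂_le fun i hi => ?_
    rw [MeasurableSpace.comap_le_iff_le_map]
    intro t ht
    exact ⟨(fun x : S → A => x ⟨i, hi⟩) ⁻¹' t, measurable_pi_apply _ ht, rfl⟩
  obtain ⟨t, -, ht⟩ := hle _ (hf (measurableSet_singleton (f ω)))
  have hr : (fun i : S => ω i) = fun i : S => ω' i := funext fun i => h i i.2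
  have h1 : ω ∈ f ⁻¹' {f ω} := rfl
  rw [← ht, Set.mem_preimage, hr, ← Set.mem_preimage (f := fun (ω : Config d A) (i : S) => ω i), ht]
    at h1
  exact h1.symm

/-- Properness, applied to the events `ξ i ≠ ω i` at the countably many sites outside `Λ`. -/
theorem IsSpecification.ae_eq_off [DiscreteMeasurableSpace A] (hγ : IsSpecification γ)
    (Λ : Finset (Site d)) (ω : Config d A) : ∀ᵐ ξ ∂(γ Λ ω), ∀ i ∉ Λ, ξ i = ω i := by
  rw [ae_all_iff]
  intro i
  by_cases hi : i ∈ Λ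
  · simp [hi]
  have hm : MeasurableSet[cylinderEvents ((Λ : Set (Site d))ᶜ)] {ξ : Config d A | ¬ ξ i = ω i} :=
    have hi' : i ∈ ((Λ : Set (Site d))ᶜ) := by simpa using hi
    have hx : Measurable[cylinderEvents ((Λ : Set (Site d))ᶜ)] fun ξ : Config d A => ξ i :=
      measurable_cylinderEvent_apply hi'
    hx (MeasurableSet.of_discrete (s := {x : A | ¬ x = ω i}))
  simp only [hi, not_false_eq_true, true_imp_iff]
  rw [ae_iff, hγ.proper Λ _ hm]
  simp

theorem measurableSet_apply_eq [DiscreteMeasurableSpace A] (i : Site d) (a : A) :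
    MeasurableSet {ξ : Config d A | ξ i = a} :=
  have hx : Measurable fun ξ : Config d A => ξ i := measurable_pi_apply i
  hx (MeasurableSet.of_discrete (s := {a}))

theorem IsTranslationCovariant.apply_singleton [DiscreteMeasurableSpace A]
    (hc : IsTranslationCovariant γ) (j : Site d) (ω : Config d A) (a : A) :
    γ {0} (shift j ω) {ξ | ξ 0 = a} = γ {j} ω {ξ | ξ j = a} := by
  have hs : Measurable (shift j : Config d A → Config d A) :=
    measurable_pi_iff.2 fun i => measurable_pi_apply (j + i)
  rw [hc j {0} ω, Measure.map_apply hs (measurableSet_apply_eq 0 a)]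
  simp [shift]

/-- If the context of `i` is contained in the box of radius `m`, then the one-site probabilities at
all sites with the same pattern of radius `m` coincide. -/
theorem Determines.apply_eq_of_window_eq [DiscreteMeasurableSpace A] (hγ : IsSpecification γ)
    (hc : IsTranslationCovariant γ) {i j : Site d} {σ ω : Config d A} {Γ : Set (Site d)} {m : ℕ}
    (hΓ : Determines γ {i} σ Γ) (hm : Γ ⊆ (box i m : Set (Site d)))
    (hw : window m j ω = window m i σ) (a : A) :
    γ {j} ω {ξ | ξ j = a} = γ {i} σ {ξ | ξ i = a} := by
  classical
  set ω' : Config d A := shift (j - i) ω with hω'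
  have h1 : γ {j} ω {ξ | ξ j = a} = γ {i} ω' {ξ | ξ i = a} := by
    have : shift j ω = shift i ω' := by
      funext l
      simp [hω', shift, ← add_assoc]
    rw [← hc.apply_singleton j, this, hc.apply_singleton]
  -- Windows omit the center, while `Γ` might contain `i`. The kernel at `i` ignores the symbol at
  -- `i`, so that symbol may be set to `σ i`.
  have h2 : γ {i} ω' {ξ | ξ i = a} = γ {i} (Function.update ω' i (σ i)) {ξ | ξ i = a} :=
    eq_of_measurable_cylinderEvents (hγ.measurable_compl {i} _ (measurableSet_apply_eq i a)) fun l hl => by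
      rw [Function.update_of_ne (by simpa using hl)]
  rw [h1, h2]
  have h3 := hΓ (Function.update ω' i (σ i)) (fun l hl => ?_) (fun _ => a)
  · simpa using h3
  · by_cases hli : l = i
    · subst hli; simp
    · rw [Function.update_of_ne hli]
      have hb : l - i ∈ pbox d m := by
        refine Finset.mem_erase.2 ⟨sub_ne_zero.2 hli, ?_⟩
        have := mem_box.1 (hm hl)
        rw [mem_box, zero_sub, norm_neg, ← norm_neg, neg_sub]
        exact this
      have := congrFun hw ⟨l - i, hb⟩
      simp only [window] at this
      rw [add_sub_cancel] at this
      rw [← this, hω', shift]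
      congr 1
      abel

/-- One-site consistency: a factor whose conditional expectation at `j` is at most one can be
removed from a product, if the other factor does not depend on the symbol at `j`. -/
theorem IsConsistent.lintegral_mul_le [DiscreteMeasurableSpace A] {μ : Measure (Config d A)}
    (hγ : IsSpecification γ) (hμ : IsConsistent μ γ) {j : Site d} {G h : Config d A → ENNReal}
    (hG : Measurable G) (hh : Measurable h)
    (hGj : ∀ ω ω' : Config d A, (∀ i ≠ j, ω i = ω' i) → G ω = G ω')
    (hle : ∀ ω, ∫⁻ ξ, h ξ ∂(γ {j} ω) ≤ 1) :
    ∫⁻ ω, G ω * h ω ∂μ ≤ ∫⁻ ω, G ω ∂μ := by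
  -- Consistency says that resampling the site `j` leaves `μ` invariant.
  have hb : μ = μ.bind (γ {j}) := by
    ext E hE
    rw [Measure.bind_apply hE (Kernel.aemeasurable _), hμ {j} E hE]
  calc ∫⁻ ω, G ω * h ω ∂μ = ∫⁻ ω, G ω * h ω ∂(μ.bind (γ {j})) := by rw [← hb]
    _ = ∫⁻ ω, ∫⁻ ξ, G ξ * h ξ ∂(γ {j} ω) ∂μ :=
      Measure.lintegral_bind (Kernel.aemeasurable _) (hG.mul hh).aemeasurable
    _ ≤ ∫⁻ ω, G ω ∂μ := by
      refine lintegral_mono fun ω => ?_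
      have : ∫⁻ ξ, G ξ * h ξ ∂(γ {j} ω) = ∫⁻ ξ, G ω * h ξ ∂(γ {j} ω) := by
        refine lintegral_congr_ae ?_
        filter_upwards [hγ.ae_eq_off {j} ω] with ξ hξ
        rw [hGj ξ ω fun i hi => hξ i (by simpa using hi)]
      rw [this, lintegral_const_mul _ hh]
      exact mul_le_of_le_one_right' (hle ω)

/-- Replaces a martingale argument: each site is resampled in turn, and its factor is removed
because the remaining factors do not see that site. -/
theorem IsConsistent.lintegral_prod_le_one [DiscreteMeasurableSpace A] {μ : Measure (Config d A)}
    [IsProbabilityMeasure μ] (hγ : IsSpecification γ) (hμ : IsConsistent μ γ)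
    (s : Finset (Site d)) (h : Site d → Config d A → ENNReal) (hh : ∀ j, Measurable (h j))
    (hdep : ∀ j ∈ s, ∀ l ∈ s, l ≠ j → ∀ ω ω' : Config d A, (∀ i ≠ j, ω i = ω' i) →
      h l ω = h l ω')
    (hle : ∀ j ∈ s, ∀ ω, ∫⁻ ξ, h j ξ ∂(γ {j} ω) ≤ 1) :
    ∫⁻ ω, ∏ j ∈ s, h j ω ∂μ ≤ 1 := by
  induction s using Finset.induction_on with
  | empty => simp
  | insert j s hj ih =>
    simp_rw [Finset.prod_insert hj, mul_comm (h j _)]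
    refine (hμ.lintegral_mul_le hγ (Finset.measurable_prod _ fun l _ => hh l) (hh j)
      (fun ω ω' hω => Finset.prod_congr rfl fun l hl => ?_)
      (hle j (Finset.mem_insert_self j s))).trans
      (ih (fun j' hj' l hl => hdep j' (Finset.mem_insert_of_mem hj') l
        (Finset.mem_insert_of_mem hl)) fun j' hj' => hle j' (Finset.mem_insert_of_mem hj'))
    exact hdep j (Finset.mem_insert_self j s) l (Finset.mem_insert_of_mem hl)
      (fun h => hj (h ▸ hl)) ω ω' hω

/-- Hoeffding's lemma for an event. -/
theorem lintegral_exp_indicator_le_one {Ω : Type*} [MeasurableSpace Ω] {ν : Measure Ω}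
    [IsProbabilityMeasure ν] {E : Set Ω} (hE : MeasurableSet E) (t : ℝ) :
    ∫⁻ ξ, ENNReal.ofReal (Real.exp (t * (E.indicator 1 ξ - ν.real E) - t ^ 2 / 8)) ∂ν ≤ 1 := by
  have hX : Measurable (E.indicator (1 : Ω → ℝ)) := measurable_one.indicator hE
  have hI : ∀ ω, E.indicator (1 : Ω → ℝ) ω ∈ Set.Icc (0 : ℝ) 1 := fun ω => by
    by_cases h : ω ∈ E <;> simp [h]
  -- A variable with range of length 1 has variance proxy `1/4`, whence `t ^ 2 / 8`.
  have hs := hasSubgaussianMGF_of_mem_Icc (μ := ν) hX.aemeasurable (ae_of_all _ hI)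
  rw [integral_indicator_one hE] at hs
  have hexp : ∀ ξ, Real.exp (t * (E.indicator 1 ξ - ν.real E) - t ^ 2 / 8) =
      Real.exp (t * (E.indicator 1 ξ - ν.real E)) * Real.exp (-(t ^ 2 / 8)) := fun ξ => by
    rw [← Real.exp_add, sub_eq_add_neg (t * _)]
  simp_rw [hexp]
  rw [← ofReal_integral_eq_lintegral_ofReal ((hs.integrable_exp_mul t).mul_const _)
    (ae_of_all _ fun ξ => by positivity), integral_mul_const, ← ENNReal.ofReal_one]
  refine ENNReal.ofReal_le_ofReal ?_
  have h1 := hs.mgf_le t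
  have h2 : ((‖(1 : ℝ) - 0‖₊ / 2) ^ 2 : NNReal) * t ^ 2 / 2 = t ^ 2 / 8 := by
    simp; ring
  rw [h2, mgf] at h1
  calc _ ≤ Real.exp (t ^ 2 / 8) * Real.exp (-(t ^ 2 / 8)) := by gcongr
    _ = 1 := by rw [← Real.exp_add]; simp

end Specification

end VNRF

namespace VNRF

/-! ### Log-likelihood ratios and chi-square distances. -/

section Likelihood

/-- The log-likelihood ratio of the classes `i ∈ I` with symbol counts `n i` against the pooled
counts is at most the sum of the chi-square distances to any positive probability vector. -/
theorem sum_mul_klInfo_le {ι A : Type*} [Fintype A] (I : Finset ι) (n : ι → A → ℝ)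
    (hn : ∀ i a, 0 ≤ n i a) (m : ι → ℝ) (hm : ∀ i, m i = ∑ a, n i a) (n₀ : A → ℝ)
    (hn₀ : ∀ a, n₀ a = ∑ i ∈ I, n i a) (m₀ : ℝ) (hm₀ : m₀ = ∑ a, n₀ a) (p : A → ℝ)
    (hp : ∀ a, 0 < p a) (hp1 : ∑ a, p a = 1) :
    ∑ i ∈ I, m i * klInfo (fun a => n i a / m i) (fun a => n₀ a / m₀) ≤
      ∑ i ∈ I, ∑ a, (n i a - p a * m i) ^ 2 / (m i * p a) := by
  have hle : ∀ i a, n i a ≤ m i := fun i a => by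
    rw [hm]; exact Finset.single_le_sum (fun a _ => hn i a) (Finset.mem_univ a)
  have hn₀0 : ∀ a, 0 ≤ n₀ a := fun a => by rw [hn₀]; exact Finset.sum_nonneg fun i _ => hn i a
  have hle₀ : ∀ a, n₀ a ≤ m₀ := fun a => by
    rw [hm₀]; exact Finset.single_le_sum (fun a _ => hn₀0 a) (Finset.mem_univ a)
  -- The reference law `p` is inserted in the logarithm: class divergence from `p` minus pooled
  -- divergence from `p`.
  have key : ∀ i ∈ I, ∀ a, m i * ((n i a / m i) * Real.log ((n i a / m i) / (n₀ a / m₀))) =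
      n i a * Real.log (n i a / m i / p a) - n i a * Real.log (n₀ a / m₀ / p a) := by
    intro i hi a
    rcases (hn i a).eq_or_lt with h | h
    · simp [← h]
    have hmi : 0 < m i := h.trans_le (hle i a)
    have h₀ : 0 < n₀ a := by
      rw [hn₀]
      exact h.trans_le (Finset.single_le_sum (f := fun i => n i a) (fun i _ => hn i a) hi)
    have hm₀' : 0 < m₀ := h₀.trans_le (hle₀ a)
    rw [← mul_sub, ← Real.log_div (div_pos (div_pos h hmi) (hp a)).ne'
      (div_pos (div_pos h₀ hm₀') (hp a)).ne', div_div_div_cancel_right₀ (hp a).ne', ← mul_assoc,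
      mul_div_cancel₀ _ hmi.ne']
  -- Gibbs' inequality: the pooled divergence is nonnegative and can be dropped.
  have hpool : 0 ≤ ∑ a, n₀ a * Real.log (n₀ a / m₀ / p a) := by
    have : ∀ a, n₀ a - m₀ * p a ≤ n₀ a * Real.log (n₀ a / m₀ / p a) := by
      intro a
      rcases (hn₀0 a).eq_or_lt with h | h
      · have h0 : 0 ≤ m₀ := by simpa [← h] using hle₀ a
        simpa [← h] using mul_nonneg h0 (hp a).le
      have hm₀' : 0 < m₀ := h.trans_le (hle₀ a)
      have hx : 0 < n₀ a / m₀ / p a := div_pos (div_pos h hm₀') (hp a)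
      calc n₀ a - m₀ * p a = n₀ a * (1 - (n₀ a / m₀ / p a)⁻¹) := by
            field_simp
        _ ≤ _ := mul_le_mul_of_nonneg_left (Real.one_sub_inv_le_log_of_pos hx) h.le
    refine le_trans (le_of_eq ?_) (Finset.sum_le_sum fun a _ => this a)
    rw [Finset.sum_sub_distrib, ← Finset.mul_sum, hp1, ← hm₀]
    ring
  have hclass : ∀ i, ∑ a, n i a * Real.log (n i a / m i / p a) ≤
      ∑ a, (n i a - p a * m i) ^ 2 / (m i * p a) := by
    intro i
    have hmi0 : 0 ≤ m i := by rw [hm]; exact Finset.sum_nonneg fun a _ => hn i a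
    rcases hmi0.eq_or_lt with h | h
    · simp [← h]
    -- From `log x ≤ x - 1`; the linear correction sums to zero over `a`.
    have hterm : ∀ a, n i a * Real.log (n i a / m i / p a) ≤
        (n i a - p a * m i) ^ 2 / (m i * p a) + (n i a - m i * p a) := by
      intro a
      have hpa := hp a
      have : (n i a - p a * m i) ^ 2 / (m i * p a) + (n i a - m i * p a) =
          n i a * (n i a / m i / p a - 1) := by
        field_simp
        ring
      rw [this]
      rcases (hn i a).eq_or_lt with h' | h'
      · simp [← h']
      · exact mul_le_mul_of_nonneg_left
          (Real.log_le_sub_one_of_pos (div_pos (div_pos h' h) hpa)) h'.le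
    refine (Finset.sum_le_sum fun a _ => hterm a).trans (le_of_eq ?_)
    rw [Finset.sum_add_distrib, Finset.sum_sub_distrib, ← Finset.mul_sum, hp1, ← hm]
    ring
  have hexp : ∑ i ∈ I, m i * klInfo (fun a => n i a / m i) (fun a => n₀ a / m₀) =
      ∑ i ∈ I, ∑ a, n i a * Real.log (n i a / m i / p a) -
        ∑ a, n₀ a * Real.log (n₀ a / m₀ / p a) := by
    have : ∑ a, n₀ a * Real.log (n₀ a / m₀ / p a) =
        ∑ i ∈ I, ∑ a, n i a * Real.log (n₀ a / m₀ / p a) := by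
      rw [Finset.sum_comm]
      exact Finset.sum_congr rfl fun a _ => by rw [← Finset.sum_mul, ← hn₀]
    rw [this, ← Finset.sum_sub_distrib]
    refine Finset.sum_congr rfl fun i hi => ?_
    rw [klInfo, Finset.mul_sum, ← Finset.sum_sub_distrib]
    exact Finset.sum_congr rfl fun a _ => key i hi a
  rw [hexp]
  linarith [Finset.sum_le_sum fun i (_ : i ∈ I) => hclass i]

variable {d : ℕ} {A : Type*}

theorem truncate_window {ℓ : ℕ} (j : Site d) (σ : Config d A) :
    truncate (window ℓ j σ) = window (ℓ - 1) j σ := rfl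

theorem sum_countSym [Fintype A] (Λ : Finset (Site d)) (σ : Config d A) {ℓ : ℕ}
    (η : Pattern d A ℓ) : ∑ a, countSym Λ σ η a = count Λ σ η := by
  classical
  rw [count, Finset.card_eq_sum_card_fiberwise (f := σ) (t := Finset.univ) (by simp)]
  refine Finset.sum_congr rfl fun a _ => ?_
  rw [countSym, Finset.filter_filter]

open Classical in
theorem sum_countSym_extensions [Fintype A] (Λ : Finset (Site d)) (σ : Config d A) {ℓ : ℕ}
    (η : Pattern d A (ℓ - 1)) (a : A) :
    ∑ ζ ∈ (Finset.univ : Finset (Pattern d A ℓ)).filter (fun ζ => truncate ζ = η),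
      countSym Λ σ ζ a = countSym Λ σ η a := by
  rw [countSym, Finset.card_eq_sum_card_fiberwise (f := fun j => window ℓ j σ)
    (t := (Finset.univ : Finset (Pattern d A ℓ)).filter (fun ζ => truncate ζ = η))]
  · refine Finset.sum_congr rfl fun ζ hζ => ?_
    have hζ' : truncate ζ = η := by simpa using hζ
    rw [countSym, Finset.filter_filter]
    congr 1
    ext j
    simp only [Finset.mem_filter]
    constructor
    · rintro ⟨h1, h2, h3⟩
      refine ⟨h1, ⟨?_, h3⟩, h2⟩
      rw [← truncate_window, h2, hζ']
    · rintro ⟨h1, ⟨-, h3⟩, h2⟩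
      exact ⟨h1, h2, h3⟩
  · intro j hj
    simp only [Finset.coe_filter, Set.mem_ofPred_eq] at hj
    simpa [truncate_window] using hj.2.1

theorem mem_pbox {ℓ : ℕ} {j : Site d} : j ∈ pbox d ℓ ↔ j ≠ 0 ∧ ‖j‖ ≤ ℓ := by
  rw [pbox, Finset.mem_erase, mem_box, zero_sub, norm_neg]

theorem norm_lt_add_one_iff {m : ℕ} {j : Site d} : ‖j‖ < (m : ℝ) + 1 ↔ ‖j‖ ≤ m := by
  rw [pi_norm_lt_iff (by positivity), pi_norm_le_iff_of_nonneg (by positivity)]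
  refine forall_congr' fun l => ?_
  rw [Int.norm_eq_abs]
  exact_mod_cast Int.lt_add_one_iff (a := |j l|) (b := (m : ℤ))

-- The norm takes integer values, so a site of the box of radius `ℓ` is either on the sphere or
-- within radius `ℓ - 1`; an extension is determined by its symbols on the sphere.
open Classical in
theorem card_extensions_le [Fintype A] {ℓ : ℕ} (hℓ : 1 ≤ ℓ) (η : Pattern d A (ℓ - 1)) :
    ((Finset.univ : Finset (Pattern d A ℓ)).filter (fun ζ => truncate ζ = η)).card ≤
      Fintype.card A ^ (sphere d ℓ).card := by
  have hsub : ∀ j ∈ sphere d ℓ, j ∈ pbox d ℓ := by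
    intro j hj
    rw [sphere, Finset.mem_filter] at hj
    rw [mem_pbox]
    refine ⟨?_, hj.2.le⟩
    rintro rfl
    have := hj.2
    rw [norm_zero] at this
    exact absurd this (by exact_mod_cast (by omega : (0 : ℕ) ≠ ℓ))
  have hcard : Fintype.card (sphere d ℓ → A) = Fintype.card A ^ (sphere d ℓ).card := by simp
  rw [← hcard, ← Finset.card_univ]
  refine Finset.card_le_card_of_injOn
    (fun ζ (j : sphere d ℓ) => ζ ⟨j, hsub j j.2⟩) (by simp) ?_
  intro ζ hζ ζ' hζ' h
  simp only [Finset.coe_filter, Finset.mem_univ, true_and, Set.mem_ofPred_eq] at hζ hζ'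
  funext ⟨j, hj⟩
  by_cases hjs : j ∈ sphere d ℓ
  · exact congrFun h ⟨j, hjs⟩
  · have hj' := mem_pbox.1 hj
    have hj1 : j ∈ pbox d (ℓ - 1) := by
      refine mem_pbox.2 ⟨hj'.1, ?_⟩
      have hne : ‖j‖ ≠ ℓ := fun h => hjs (by
        rw [sphere, Finset.mem_filter, mem_box, zero_sub, norm_neg]
        exact ⟨hj'.2, h⟩)
      have hlt := lt_of_le_of_ne hj'.2 hne
      rw [← norm_lt_add_one_iff]
      have : ((ℓ - 1 : ℕ) : ℝ) + 1 = ℓ := by exact_mod_cast Nat.sub_add_cancel hℓ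
      rwa [this]
    exact congrFun (hζ.trans hζ'.symm) ⟨j, hj1⟩

/-- If all the empirical counts of extensions of `σ_i^(ℓ-1)` are close to those predicted by `p`,
then the log-likelihood ratio does not exceed the penalty. -/
theorem logL_le_pen [Fintype A] {δ : ℝ} (hδ : 0 ≤ δ) (Λ : Finset (Site d)) (σ : Config d A)
    (i : Site d) {ℓ : ℕ} (hℓ : 1 ≤ ℓ) (p : A → ℝ) (hp : ∀ a, 0 < p a) (hp1 : ∑ a, p a = 1)
    (h : ∀ ζ : Pattern d A ℓ, truncate ζ = window (ℓ - 1) i σ → ∀ a,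
      ((countSym Λ σ ζ a : ℝ) - p a * count Λ σ ζ) ^ 2 ≤
        count Λ σ ζ * (p a * (kappa d δ * Real.log Λ.card))) :
    logL Λ σ i ℓ ≤ pen A δ Λ ℓ := by
  classical
  set η := window (ℓ - 1) i σ with hη
  set I := (Finset.univ : Finset (Pattern d A ℓ)).filter (fun ζ => truncate ζ = η) with hI
  have hT : 0 ≤ kappa d δ * Real.log Λ.card :=
    mul_nonneg (by unfold kappa; positivity) (Real.log_natCast_nonneg _)
  have h1 := sum_mul_klInfo_le I (fun ζ a => (countSym Λ σ ζ a : ℝ)) (fun _ _ => by positivity)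
    (fun ζ => (count Λ σ ζ : ℝ)) (fun ζ => by rw [← sum_countSym]; push_cast; rfl)
    (fun a => (countSym Λ σ η a : ℝ))
    (fun a => by rw [← sum_countSym_extensions]; push_cast; rfl)
    (count Λ σ η) (by rw [← sum_countSym]; push_cast; rfl) p hp hp1
  have h2 : ∀ ζ ∈ I, ∀ a, ((countSym Λ σ ζ a : ℝ) - p a * count Λ σ ζ) ^ 2 /
      (count Λ σ ζ * p a) ≤ kappa d δ * Real.log Λ.card := by
    intro ζ hζ a
    rcases Nat.eq_zero_or_pos (count Λ σ ζ) with h0 | h0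
    · simpa [h0] using hT
    · have : (0 : ℝ) < count Λ σ ζ := by exact_mod_cast h0
      rw [div_le_iff₀ (mul_pos this (hp a))]
      refine (h ζ (by simpa [hI] using hζ) a).trans (le_of_eq (by ring))
  calc logL Λ σ i ℓ ≤ ∑ ζ ∈ I, ∑ a, ((countSym Λ σ ζ a : ℝ) - p a * count Λ σ ζ) ^ 2 /
      (count Λ σ ζ * p a) := h1
    _ ≤ ∑ ζ ∈ I, ∑ _a : A, kappa d δ * Real.log Λ.card :=
      Finset.sum_le_sum fun ζ hζ => Finset.sum_le_sum fun a _ => h2 ζ hζ a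
    _ = I.card * (Fintype.card A * (kappa d δ * Real.log Λ.card)) := by simp
    _ ≤ (Fintype.card A : ℝ) ^ (sphere d ℓ).card *
        (Fintype.card A * (kappa d δ * Real.log Λ.card)) := by
      gcongr
      exact_mod_cast card_extensions_le hℓ η
    _ = pen A δ Λ ℓ := by unfold pen; ring

end Likelihood

end VNRF

namespace VNRF

/-! ### Self-normalized Hoeffding bounds for pattern counts. -/

section Deviation

variable {d : ℕ} {A : Type*}

open Classical in
/-- The sites of `s` at which the pattern `η` is seen. -/
noncomputable def occurrences {k : ℕ} (s : Finset (Site d)) (η : Pattern d A k) (σ : Config d A) :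
    Finset (Site d) :=
  s.filter fun j => window k j σ = η

/-- The centered count of the symbol `a` at the occurrences of the pattern `η` in `s`. -/
noncomputable def deviation {k : ℕ} (s : Finset (Site d)) (η : Pattern d A k) (a : A) (p : ℝ)
    (σ : Config d A) : ℝ :=
  ∑ j ∈ occurrences s η σ, (({a} : Set A).indicator 1 (σ j) - p)

theorem deviation_security {k : ℕ} (Λ : Finset (Site d)) (η : Pattern d A k) (a : A) (p : ℝ)
    (σ : Config d A) :
    deviation (security Λ) η a p σ = countSym Λ σ η a - p * count Λ σ η := by
  classical
  rw [deviation, Finset.sum_sub_distrib, Finset.sum_const, nsmul_eq_mul, mul_comm p, countSym,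
    ← Finset.filter_filter, Finset.card_filter, Nat.cast_sum]
  congr 1
  refine Finset.sum_congr rfl fun j _ => ?_
  by_cases h : σ j = a <;> simp [h]

variable [MeasurableSpace A] [DiscreteMeasurableSpace A]

theorem measurableSet_window_eq [Fintype A] {k : ℕ} (j : Site d) (η : Pattern d A k) :
    MeasurableSet {σ : Config d A | window k j σ = η} := by
  have : Measurable (fun σ : Config d A => window k j σ) :=
    measurable_pi_iff.2 fun l => measurable_pi_apply (j + (l : Site d))
  exact this (measurableSet_singleton η)

theorem measurable_card_occurrences [Fintype A] {k : ℕ} (s : Finset (Site d))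
    (η : Pattern d A k) : Measurable fun σ : Config d A => ((occurrences s η σ).card : ℝ) := by
  classical
  simp_rw [occurrences, Finset.card_filter, Nat.cast_sum]
  refine Finset.measurable_sum _ fun j _ => ?_
  simp_rw [Nat.cast_ite]
  exact Measurable.ite (measurableSet_window_eq j η) measurable_const measurable_const

/-- Hoeffding's inequality for the symbols at the occurrences of `η` in a set of sites that do not
lie in each other's windows, when the symbol `a` has probability `p` given the pattern `η`. -/
theorem IsConsistent.measure_deviation_le [Fintype A]
    {γ : Finset (Site d) → Kernel (Config d A) (Config d A)} {μ : Measure (Config d A)}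
    [IsProbabilityMeasure μ] (hγ : IsSpecification γ) (hμ : IsConsistent μ γ) {k : ℕ}
    {s : Finset (Site d)} (hs : ∀ j ∈ s, ∀ l ∈ s, j ≠ l → ¬ ‖j - l‖ ≤ k) {η : Pattern d A k}
    {a : A} {p : ℝ} (hp : ∀ j ω, window k j ω = η → (γ {j} ω).real {ξ | ξ j = a} = p)
    {t : ℝ} (ht : 0 ≤ t) {c : ℝ} (hc : c ^ 2 = 1) :
    μ {σ | √(t * (occurrences s η σ).card) < c * deviation s η a p σ} ≤
      ENNReal.ofReal (Real.exp (-(2 * t))) := by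
  classical
  have hwin : ∀ j ∈ s, ∀ l ∈ s, ∀ ω ω' : Config d A, (∀ i ≠ j, ω i = ω' i) →
      window k l ω = window k l ω' := by
    intro j hj l hl ω ω' h
    funext ⟨o, ho⟩
    have ho' := mem_pbox.1 ho
    refine h _ fun hlo => ?_
    by_cases hjl : j = l
    · subst hjl
      exact ho'.1 (by simpa using hlo)
    · refine hs j hj l hl hjl ?_
      rw [← hlo, add_sub_cancel_left]
      exact ho'.2
  have hocc : ∀ j ∈ s, ∀ ω ω' : Config d A, (∀ i ≠ j, ω i = ω' i) →
      occurrences s η ω = occurrences s η ω' := fun j hj ω ω' h =>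
    Finset.filter_congr fun l hl => by rw [hwin j hj l hl ω ω' h]
  -- With `N` occurrences, `4√(t/N)` maximizes `x√(tN) - N x²/8`, with value `2t`. The tilt depends
  -- on `σ` only through `N`, so it is fixed when a site of `s` is resampled. The sign `c` selects
  -- the tail.
  set lam : Config d A → ℝ := fun σ => c * (4 * √(t / (occurrences s η σ).card)) with hlam
  have hlamm : Measurable lam :=
    (((measurable_card_occurrences s η).const_div t).sqrt.const_mul 4).const_mul c
  set e : Site d → Config d A → ℝ := fun j σ =>
    lam σ * (({a} : Set A).indicator 1 (σ j) - p) - lam σ ^ 2 / 8 with he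
  have hem : ∀ j, Measurable (e j) := fun j => by
    have h1 : Measurable fun σ : Config d A => ({a} : Set A).indicator (1 : A → ℝ) (σ j) :=
      (Measurable.of_discrete (f := ({a} : Set A).indicator (1 : A → ℝ))).comp
        (measurable_pi_apply j)
    exact (hlamm.mul (h1.sub_const p)).sub ((hlamm.pow_const 2).div_const 8)
  -- The factor 1 off the occurrences turns a product over the random set of occurrences into one
  -- over the fixed set `s`.
  set h : Site d → Config d A → ENNReal := fun j σ =>
    if window k j σ = η then ENNReal.ofReal (Real.exp (e j σ)) else 1 with hh
  have hhm : ∀ j, Measurable (h j) := fun j =>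
    Measurable.ite (measurableSet_window_eq j η) (hem j).exp.ennreal_ofReal measurable_const
  have hint : ∫⁻ σ, ∏ j ∈ s, h j σ ∂μ ≤ 1 := by
    refine hμ.lintegral_prod_le_one hγ s h hhm ?_ ?_
    · intro j hj l hl hlj ω ω' hω
      simp only [hh, he, hlam, hwin j hj l hl ω ω' hω, hocc j hj ω ω' hω, hω l hlj]
    · intro j hj ω
      have := hγ.isMarkov {j}
      have hcongr : ∫⁻ ξ, h j ξ ∂(γ {j} ω) = ∫⁻ ξ, (if window k j ω = η then ENNReal.ofReal
          (Real.exp (lam ω * ({ξ | ξ j = a}.indicator 1 ξ - p) - lam ω ^ 2 / 8)) else 1)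
          ∂(γ {j} ω) := by
        refine lintegral_congr_ae ?_
        filter_upwards [hγ.ae_eq_off {j} ω] with ξ hξ
        have hξ' : ∀ i ≠ j, ξ i = ω i := fun i hi => hξ i (by simpa using hi)
        have hind : ({a} : Set A).indicator (1 : A → ℝ) (ξ j) =
            {ξ : Config d A | ξ j = a}.indicator 1 ξ := by
          by_cases hξa : ξ j = a <;> simp [hξa]
        simp only [hh, he, hlam, hwin j hj j hj ξ ω hξ', hocc j hj ξ ω hξ', hind]
      rw [hcongr]
      by_cases hw : window k j ω = η
      · simp only [hw, if_true]
        rw [← hp j ω hw]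
        exact lintegral_exp_indicator_le_one (measurableSet_apply_eq j a) (lam ω)
      · simp [hw]
  have hprod : ∀ σ, ∏ j ∈ s, h j σ = ENNReal.ofReal (Real.exp (lam σ * deviation s η a p σ -
      (occurrences s η σ).card * (lam σ ^ 2 / 8))) := by
    intro σ
    rw [hh, ← Finset.prod_filter, ← ENNReal.ofReal_prod_of_nonneg fun _ _ => (Real.exp_pos _).le,
      ← Real.exp_sum]
    congr 2
    simp only [he]
    rw [Finset.sum_sub_distrib, ← Finset.mul_sum, Finset.sum_const, nsmul_eq_mul]
    rfl
  have hsub : {σ | √(t * (occurrences s η σ).card) < c * deviation s η a p σ} ⊆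
      {σ | ENNReal.ofReal (Real.exp (2 * t)) ≤ ∏ j ∈ s, h j σ} := by
    intro σ hσ
    rw [Set.mem_ofPred_eq] at hσ ⊢
    rw [hprod]
    refine ENNReal.ofReal_le_ofReal (Real.exp_le_exp.2 ?_)
    -- Without occurrences the strict inequality would read `0 < 0`.
    rcases Nat.eq_zero_or_pos (occurrences s η σ).card with h0 | h0
    · rw [Finset.card_eq_zero] at h0
      simp [deviation, h0] at hσ
    have hN : (0 : ℝ) < (occurrences s η σ).card := by exact_mod_cast h0
    set N : ℝ := ((occurrences s η σ).card : ℝ)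
    have h1 : √(t / N) * √(t * N) = t := by
      rw [← Real.sqrt_mul (by positivity), show t / N * (t * N) = t ^ 2 by field_simp,
        Real.sqrt_sq ht]
    have h2 : lam σ ^ 2 = 16 * (t / N) := by
      simp only [hlam]
      rw [mul_pow, hc, mul_pow, Real.sq_sqrt (by positivity)]
      ring
    have h3 : N * (lam σ ^ 2 / 8) = 2 * t := by rw [h2]; field_simp; ring
    have h4 : 4 * t ≤ lam σ * deviation s η a p σ := by
      calc 4 * t = 4 * √(t / N) * √(t * N) := by rw [mul_assoc, h1]
        _ ≤ 4 * √(t / N) * (c * deviation s η a p σ) := by gcongr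
        _ = _ := by simp only [hlam]; ring
    linarith
  have hpos : ENNReal.ofReal (Real.exp (2 * t)) ≠ 0 := by
    simpa using Real.exp_pos (2 * t)
  calc _ ≤ μ {σ | ENNReal.ofReal (Real.exp (2 * t)) ≤ ∏ j ∈ s, h j σ} := measure_mono hsub
    _ ≤ (∫⁻ σ, ∏ j ∈ s, h j σ ∂μ) / ENNReal.ofReal (Real.exp (2 * t)) :=
      meas_ge_le_lintegral_div (Finset.measurable_prod _ fun j _ => hhm j).aemeasurable hpos
        ENNReal.ofReal_ne_top
    _ ≤ 1 / ENNReal.ofReal (Real.exp (2 * t)) := by gcongr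
    _ = _ := by
      rw [one_div, ← ENNReal.ofReal_inv_of_pos (Real.exp_pos _), Real.exp_neg]

theorem IsConsistent.measureReal_sq_deviation_le [Fintype A]
    {γ : Finset (Site d) → Kernel (Config d A) (Config d A)} {μ : Measure (Config d A)}
    [IsProbabilityMeasure μ] (hγ : IsSpecification γ) (hμ : IsConsistent μ γ) {k : ℕ}
    {s : Finset (Site d)} (hs : ∀ j ∈ s, ∀ l ∈ s, j ≠ l → ¬ ‖j - l‖ ≤ k) {η : Pattern d A k}
    {a : A} {p : ℝ} (hp : ∀ j ω, window k j ω = η → (γ {j} ω).real {ξ | ξ j = a} = p)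
    {t : ℝ} (ht : 0 ≤ t) :
    μ.real {σ | t * (occurrences s η σ).card < deviation s η a p σ ^ 2} ≤
      2 * Real.exp (-(2 * t)) := by
  have key : ∀ c : ℝ, c ^ 2 = 1 →
      μ.real {σ | √(t * (occurrences s η σ).card) < c * deviation s η a p σ} ≤
        Real.exp (-(2 * t)) := fun c hc =>
    ENNReal.toReal_le_of_le_ofReal (Real.exp_pos _).le (hμ.measure_deviation_le hγ hs hp ht hc)
  have hsub : {σ | t * (occurrences s η σ).card < deviation s η a p σ ^ 2} ⊆
      {σ | √(t * (occurrences s η σ).card) < 1 * deviation s η a p σ} ∪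
        {σ | √(t * (occurrences s η σ).card) < -1 * deviation s η a p σ} := by
    intro σ hσ
    have h1 := Real.sqrt_lt_sqrt (by positivity) hσ
    rw [Real.sqrt_sq_eq_abs, lt_abs] at h1
    simpa using h1
  calc _ ≤ _ := measureReal_mono hsub
    _ ≤ _ := measureReal_union_le _ _
    _ ≤ _ := by linarith [key 1 (by norm_num), key (-1) (by norm_num)]

/-- Two distinct sites that are congruent modulo `k + 1` are at distance more than `k`. -/
theorem not_norm_sub_le_of_cast_eq {k : ℕ} {j l : Site d}
    (h : ∀ m, ((j m : ℤ) : ZMod (k + 1)) = ((l m : ℤ) : ZMod (k + 1))) (hjl : j ≠ l) :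
    ¬ ‖j - l‖ ≤ k := by
  intro hle
  refine hjl (funext fun m => ?_)
  have h1 := (pi_norm_le_iff_of_nonneg (Nat.cast_nonneg k)).1 hle m
  rw [Int.norm_eq_abs, Pi.sub_apply] at h1
  have h2 : |j m - l m| ≤ (k : ℤ) := by exact_mod_cast h1
  have h3 := (ZMod.intCast_eq_intCast_iff_dvd_sub _ _ _).1 (h m)
  have h4 := Int.eq_zero_of_abs_lt_dvd h3 (by rw [abs_sub_comm]; push_cast; linarith)
  linarith

/-- The deviation inequality for an arbitrary finite set of sites, obtained by splitting it into
the residue classes modulo `k + 1`. -/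
theorem IsConsistent.measureReal_sq_deviation_le_of_residues [Fintype A]
    {γ : Finset (Site d) → Kernel (Config d A) (Config d A)} {μ : Measure (Config d A)}
    [IsProbabilityMeasure μ] (hγ : IsSpecification γ) (hμ : IsConsistent μ γ) {k : ℕ}
    (s : Finset (Site d)) {η : Pattern d A k}
    {a : A} {p : ℝ} (hp : ∀ j ω, window k j ω = η → (γ {j} ω).real {ξ | ξ j = a} = p)
    {t : ℝ} (ht : 0 ≤ t) :
    μ.real {σ | ((k : ℝ) + 1) ^ d * t * (occurrences s η σ).card < deviation s η a p σ ^ 2} ≤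
      ((k : ℝ) + 1) ^ d * (2 * Real.exp (-(2 * t))) := by
  classical
  set ρ : Site d → (Fin d → ZMod (k + 1)) := fun j m => ((j m : ℤ) : ZMod (k + 1)) with hρ
  have hcard : ((Finset.univ : Finset (Fin d → ZMod (k + 1))).card : ℝ) = ((k : ℝ) + 1) ^ d := by
    simp [ZMod.card]
  set S : (Fin d → ZMod (k + 1)) → Finset (Site d) := fun r => s.filter fun j => ρ j = r with hS
  have hocc : ∀ r σ, occurrences (S r) η σ = (occurrences s η σ).filter fun j => ρ j = r :=
    fun r σ => Finset.filter_comm _ _ _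
  have hdev : ∀ σ, deviation s η a p σ = ∑ r, deviation (S r) η a p σ := fun σ => by
    simp_rw [deviation, hocc]
    exact (Finset.sum_fiberwise _ _ _).symm
  have hN : ∀ σ, ((occurrences s η σ).card : ℝ) = ∑ r, ((occurrences (S r) η σ).card : ℝ) :=
    fun σ => by
    simp_rw [hocc]
    exact_mod_cast Finset.card_eq_sum_card_fiberwise (by simp)
  have hsub : {σ | ((k : ℝ) + 1) ^ d * t * (occurrences s η σ).card < deviation s η a p σ ^ 2} ⊆
      ⋃ r ∈ (Finset.univ : Finset (Fin d → ZMod (k + 1))),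
        {σ | t * (occurrences (S r) η σ).card < deviation (S r) η a p σ ^ 2} := by
    intro σ hσ
    by_contra hcon
    simp only [Set.mem_iUnion, Set.mem_ofPred_eq, not_exists, not_lt, Finset.mem_univ,
      true_imp_iff] at hcon
    rw [Set.mem_ofPred_eq] at hσ
    refine absurd hσ (not_lt.2 ?_)
    -- Cauchy–Schwarz over the residue classes; this is the source of the factor `(k + 1)^d` in the
    -- threshold.
    calc deviation s η a p σ ^ 2 ≤ ((k : ℝ) + 1) ^ d * ∑ r, deviation (S r) η a p σ ^ 2 := by
          rw [hdev, ← hcard]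
          exact sq_sum_le_card_mul_sum_sq
      _ ≤ ((k : ℝ) + 1) ^ d * ∑ r, t * ((occurrences (S r) η σ).card : ℝ) := by
          gcongr with r
          exact hcon r
      _ = _ := by rw [hN, ← Finset.mul_sum, mul_assoc]
  calc _ ≤ _ := measureReal_mono hsub (measure_ne_top _ _)
    _ ≤ _ := measureReal_biUnion_finset_le _ _
    _ ≤ ∑ _r : Fin d → ZMod (k + 1), 2 * Real.exp (-(2 * t)) := by
      refine Finset.sum_le_sum fun r _ => hμ.measureReal_sq_deviation_le hγ ?_ hp ht
      intro j hj l hl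
      refine not_norm_sub_le_of_cast_eq fun m => ?_
      simp only [hS, Finset.mem_filter] at hj hl
      exact congrFun (hj.2.trans hl.2.symm) m
    _ = _ := by rw [Finset.sum_const, nsmul_eq_mul, hcard]

end Deviation

end VNRF

namespace VNRF

/-! ### From overestimation to large deviations; the union bound. -/

section Overestimation

variable {d : ℕ} {A : Type*} [MeasurableSpace A]
  {γ : Finset (Site d) → Kernel (Config d A) (Config d A)}

theorem card_pbox_add_one (d k : ℕ) : (pbox d k).card + 1 = (2 * k + 1) ^ d := by
  have h0 : (0 : Site d) ∈ box 0 k := by rw [mem_box]; simp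
  have hcard : (box (0 : Site d) k).card = (2 * k + 1) ^ d := by
    rw [box, Pi.card_Icc]
    simp only [Pi.sub_apply, Pi.add_apply, Pi.zero_apply, Int.card_Icc, Finset.prod_const,
      Finset.card_univ, Fintype.card_fin]
    congr 1
    omega
  rw [pbox, Finset.card_erase_add_one h0, hcard]

theorem IsTranslationCovariant.qMin_le [DiscreteMeasurableSpace A] [Finite A]
    (hc : IsTranslationCovariant γ) (j : Site d) (ω : Config d A) (a : A) :
    qMin γ ≤ (γ {j} ω).real {ξ | ξ j = a} := by
  have h1 : qMin γ ≤ ⨅ ω : Config d A, (γ {0} ω).real {ξ | ξ 0 = a} :=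
    ciInf_le (Set.finite_range _).bddBelow a
  have h2 : (⨅ ω : Config d A, (γ {0} ω).real {ξ | ξ 0 = a}) ≤
      (γ {0} (shift j ω)).real {ξ | ξ 0 = a} :=
    ciInf_le ⟨0, by rintro _ ⟨ω, rfl⟩; exact measureReal_nonneg⟩ (shift j ω)
  refine (h1.trans h2).trans (le_of_eq ?_)
  rw [measureReal_def, hc.apply_singleton, measureReal_def]

theorem IsSpecification.sum_singleton_eq_one [DiscreteMeasurableSpace A] [Fintype A]
    (hγ : IsSpecification γ) (j : Site d) (ω : Config d A) :
    ∑ a : A, (γ {j} ω).real {ξ | ξ j = a} = 1 := by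
  have := hγ.isMarkov {j}
  rw [← measureReal_biUnion_finset (fun a _ b _ hab => Set.disjoint_left.2 fun ξ h1 h2 =>
    hab (by rw [← (show ξ j = a from h1), ← (show ξ j = b from h2)]))
    fun a _ => measurableSet_apply_eq j a]
  convert probReal_univ (μ := γ {j} ω)
  ext ξ
  simp

/-- The empirical frequency of `a` after the pattern `η` deviates from the conditional probability
of `a`, and this conditional probability is determined by `η`. -/
def largeDeviation (γ : Finset (Site d) → Kernel (Config d A) (Config d A)) (s : Finset (Site d))
    (T : ℝ) {k : ℕ} (η : Pattern d A k) (a : A) : Set (Config d A) :=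
  {σ | ∃ p : ℝ, (∀ j ω, window k j ω = η → (γ {j} ω).real {ξ | ξ j = a} = p) ∧
    p * T * (occurrences s η σ).card < deviation s η a p σ ^ 2}

/-- If the event is nonempty, a configuration in it exhibits an occurrence of `η`. This makes the
`p` of the event unique and at least `qMin γ`, so the threshold can be lowered to one with `qMin γ`
in place of `p`. -/
theorem IsConsistent.measureReal_largeDeviation_le [DiscreteMeasurableSpace A] [Fintype A]
    {μ : Measure (Config d A)} [IsProbabilityMeasure μ] (hγ : IsSpecification γ)
    (hc : IsTranslationCovariant γ) (hμ : IsConsistent μ γ) (hq : 0 ≤ qMin γ)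
    {s : Finset (Site d)} {T : ℝ} (hT : 0 ≤ T) {k : ℕ} (η : Pattern d A k) (a : A) :
    μ.real (largeDeviation γ s T η a) ≤
      ((k : ℝ) + 1) ^ d * (2 * Real.exp (-(2 * (qMin γ * T / ((k : ℝ) + 1) ^ d)))) := by
  classical
  rcases (largeDeviation γ s T η a).eq_empty_or_nonempty with h | ⟨σ, p, hp, hσ⟩
  · rw [h, measureReal_empty]; positivity
  have hne : (occurrences s η σ).Nonempty := by
    by_contra hcon
    rw [Finset.not_nonempty_iff_eq_empty] at hcon
    simp [deviation, hcon] at hσ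
  obtain ⟨j, hj⟩ := hne
  have hj' : window k j σ = η := (Finset.mem_filter.1 hj).2
  have hqp : qMin γ ≤ p := by rw [← hp j σ hj']; exact hc.qMin_le j σ a
  have hk : (0 : ℝ) < ((k : ℝ) + 1) ^ d := by positivity
  have hsub : largeDeviation γ s T η a ⊆ {σ | ((k : ℝ) + 1) ^ d *
      (qMin γ * T / ((k : ℝ) + 1) ^ d) * (occurrences s η σ).card < deviation s η a p σ ^ 2} := by
    rintro σ' ⟨p', hp', hσ'⟩
    have : p' = p := by rw [← hp j σ hj', ← hp' j σ hj']
    subst this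
    rw [Set.mem_ofPred_eq, mul_div_cancel₀ _ hk.ne']
    refine lt_of_le_of_lt ?_ hσ'
    gcongr
  exact (measureReal_mono hsub).trans
    (hμ.measureReal_sq_deviation_le_of_residues hγ s hp (by positivity))

open Classical in
/-- If the estimator exceeds a context length whose context determines the one-site law, then one of
the empirical frequencies deviates. -/
theorem exists_mem_largeDeviation [DiscreteMeasurableSpace A] [Fintype A]
    (hγ : IsSpecification γ) (hc : IsTranslationCovariant γ) (hq : 0 < qMin γ) {δ : ℝ}
    (hδ : 0 ≤ δ) {Λ : Finset (Site d)} {σ : Config d A} {i : Site d}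
    (hdet : Determines γ {i} σ (ctxSupport γ {i} σ))
    (hlt : ctxLength γ i σ < (lHat δ Λ σ i : ℕ∞)) :
    ∃ k ∈ Finset.Icc 1 (secDiam Λ), ∃ ζ : Pattern d A k, ∃ a : A,
      σ ∈ largeDeviation γ (security Λ) (kappa d δ * Real.log Λ.card) ζ a := by
  rw [ctxLength, sInf_lt_iff] at hlt
  obtain ⟨_, ⟨ℓ, rfl, hℓ0, hℓ⟩, hlt⟩ := hlt
  rw [Nat.cast_lt] at hlt
  have hnot : ℓ ∉ admissible δ Λ σ i := fun h => by
    rw [lHat, dif_pos ⟨ℓ, h⟩] at hlt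
    exact absurd (Finset.min'_le _ ℓ h) (not_le.2 hlt)
  have hle : lHat δ Λ σ i ≤ secDiam Λ := by
    rw [lHat]
    split_ifs with h
    · have := Finset.mem_Icc.1 (Finset.mem_filter.1 (Finset.min'_mem _ h)).1
      omega
    · exact le_rfl
  -- Since `ℓ < lHat ≤ R_n`, `ℓ` is in the range of candidates, so it can fail to be admissible only
  -- through the penalty.
  have : ∃ k, ℓ < k ∧ k ≤ secDiam Λ ∧ pen A δ Λ k < logL Λ σ i k := by
    by_contra! hcon
    refine hnot ?_
    rw [admissible, Finset.mem_filter, Finset.mem_Icc]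
    exact ⟨by omega, hcon⟩
  obtain ⟨k, hℓk, hkR, hpen⟩ := this
  refine ⟨k, Finset.mem_Icc.2 ⟨by omega, hkR⟩, ?_⟩
  by_contra hcon
  refine absurd (logL_le_pen hδ Λ σ i (by omega) (fun a => (γ {i} σ).real {ξ | ξ i = a})
    (fun a => hq.trans_le (hc.qMin_le i σ a)) (hγ.sum_singleton_eq_one i σ) ?_)
    (not_le.2 hpen)
  intro ζ hζ a
  by_contra hlt'
  refine hcon ⟨ζ, a, (γ {i} σ).real {ξ | ξ i = a}, fun j ω hω => ?_, ?_⟩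
  · rw [measureReal_def, measureReal_def]
    congr 1
    -- As `ℓ ≤ k - 1`, the context is already visible in the common truncation of all the extensions
    -- `ζ`.
    refine hdet.apply_eq_of_window_eq hγ hc (m := k - 1) (hℓ.trans fun l hl => ?_) ?_ a
    · have := mem_box.1 (Finset.mem_coe.1 hl)
      refine Finset.mem_coe.2 (mem_box.2 (this.trans ?_))
      exact_mod_cast (by omega : ℓ ≤ k - 1)
    · rw [← truncate_window, hω, hζ]
  · rw [deviation_security]
    rw [not_le] at hlt'
    refine lt_of_eq_of_lt ?_ hlt'
    have : (occurrences (security Λ) ζ σ).card = count Λ σ ζ := rfl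
    rw [this]
    ring

/-- The union bound over the radii, patterns and symbols. -/
theorem measureReal_overestimation_le [DiscreteMeasurableSpace A] [Fintype A]
    {μ : Measure (Config d A)} [IsProbabilityMeasure μ] (hμ : IsVariableNeighborhood μ γ)
    (hc : IsTranslationCovariant γ) (hq : 0 < qMin γ) {δ : ℝ} (hδ : 0 ≤ δ)
    (Λ : Finset (Site d)) :
    μ.real {σ | ∃ i ∈ security Λ, ctxLength γ i σ < (lHat δ Λ σ i : ℕ∞)} ≤
      ∑ k ∈ Finset.Icc 1 (secDiam Λ), (Fintype.card A : ℝ) ^ ((2 * k + 1) ^ d) *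
        (((k : ℝ) + 1) ^ d * (2 * Real.exp (-(2 * (qMin γ * (kappa d δ * Real.log Λ.card) /
          ((k : ℝ) + 1) ^ d))))) := by
  classical
  set T := kappa d δ * Real.log Λ.card
  have hT : 0 ≤ T := mul_nonneg (by unfold kappa; positivity) (Real.log_natCast_nonneg _)
  have hae : ∀ᵐ σ ∂μ, ∀ i : Site d, Determines γ {i} σ (ctxSupport γ {i} σ) := by
    rw [ae_all_iff]
    intro i
    filter_upwards [hμ.exists_support {i}] with σ hσ
    obtain ⟨Γ, -, hΓ⟩ := hσ
    rw [ctxSupport_eq_of_isLeast hΓ]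
    exact hΓ.1
  have hle : μ.real {σ | ∃ i ∈ security Λ, ctxLength γ i σ < (lHat δ Λ σ i : ℕ∞)} ≤
      μ.real (⋃ k ∈ Finset.Icc 1 (secDiam Λ),
        ⋃ x ∈ (Finset.univ : Finset (Pattern d A k × A)),
          largeDeviation γ (security Λ) T x.1 x.2) := by
    refine ENNReal.toReal_mono (measure_ne_top _ _) (measure_mono_ae ?_)
    filter_upwards [hae] with σ hσ
    rintro ⟨i, -, hi⟩
    obtain ⟨k, hk, ζ, a, h⟩ :=
      exists_mem_largeDeviation hμ.isSpecification hc hq hδ (hσ i) hi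
    change σ ∈ ⋃ k ∈ Finset.Icc 1 (secDiam Λ), _
    simp only [Set.mem_iUnion]
    exact ⟨k, hk, (ζ, a), Finset.mem_univ _, h⟩
  refine hle.trans ((measureReal_biUnion_finset_le _ _).trans (Finset.sum_le_sum fun k _ => ?_))
  refine (measureReal_biUnion_finset_le _ _).trans ((Finset.sum_le_sum fun x _ =>
    hμ.isConsistent.measureReal_largeDeviation_le hμ.isSpecification hc hq.le hT x.1 x.2).trans
    (le_of_eq ?_))
  -- The symbol `a` fills the punctured center: pairs `(ζ, a)` are as many as patterns on the full
  -- box.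
  rw [Finset.sum_const, nsmul_eq_mul, Finset.card_univ, Fintype.card_prod, ← card_pbox_add_one,
    pow_succ]
  simp

/-- Numerical comparison of the union bound with the rate `c(δ)`. -/
theorem sum_union_bound_le {d : ℕ} (hd : 1 ≤ d) {R : ℕ} {L D D' q δ : ℝ} {M : ℕ} (hM : 1 ≤ M)
    (hL : L = Real.log M) (hR : R = ⌊D ^ (1 / (2 * (d : ℝ)))⌋₊) (hD : 0 ≤ D) (hDD' : D ≤ D')
    (hq : 0 < q) (hδ : 2 ^ d * L * (3 * Real.exp 1 / (4 * q)) < δ) :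
    ∑ k ∈ Finset.Icc 1 R, (M : ℝ) ^ ((2 * k + 1) ^ d) * (((k : ℝ) + 1) ^ d *
      (2 * Real.exp (-(2 * (q * (kappa d δ * D') / ((k : ℝ) + 1) ^ d))))) ≤
      2 * 2 ^ d * D ^ (((d : ℝ) + 1) / (2 * (d : ℝ))) *
        Real.exp (-((2 / 3 * (2 * q * δ / Real.exp 1) - 2 ^ d * L) * √D)) := by
  have hL0 : 0 ≤ L := hL ▸ Real.log_natCast_nonneg _
  -- Used for `3e ≥ 8`, which gives `hx`, and for `4/(3e) ≤ 1` in `hc_le`.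
  have he := Real.exp_one_gt_d9
  have hδ0 : 0 < δ := lt_of_le_of_lt (by positivity) hδ
  have hx : 2 ^ d * L * 2 ≤ q * δ := by
    have h1 : 2 ^ d * L * (3 * Real.exp 1) < 4 * (q * δ) := by
      have := mul_lt_mul_of_pos_right hδ (by positivity : 0 < 4 * q)
      calc _ = 2 ^ d * L * (3 * Real.exp 1 / (4 * q)) * (4 * q) := by field_simp
        _ < _ := this
        _ = _ := by ring
    have h2 : 0 ≤ 2 ^ d * L := by positivity
    nlinarith
  have hd0 : (0 : ℝ) < d := by exact_mod_cast hd
  have hRle : (R : ℝ) ≤ D ^ (1 / (2 * (d : ℝ))) := hR ▸ Nat.floor_le (by positivity)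
  have hRd : (R : ℝ) ^ d ≤ √D := by
    calc (R : ℝ) ^ d ≤ (D ^ (1 / (2 * (d : ℝ)))) ^ d := by gcongr
      _ = √D := by
        rw [← Real.rpow_natCast, ← Real.rpow_mul hD, Real.sqrt_eq_rpow]
        congr 1
        field_simp
  set s := √D with hs
  have hs0 : 0 ≤ s := Real.sqrt_nonneg D
  have hss : s * s = D := Real.mul_self_sqrt hD
  set c := 2 / 3 * (2 * q * δ / Real.exp 1) - 2 ^ d * L with hc
  -- Entropy of the patterns against deviation exponent, per unit of `√D`. As `3 ≤ 2 · (5/2)`, one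
  -- of the two copies of `q δ (5/2)^d` absorbs the entropy; the other dominates `c`.
  have hc_le : 3 ^ d * L - 2 * (q * δ * (5 / 2) ^ d) ≤ -c := by
    have h1 : 2 / 3 * (2 * q * δ / Real.exp 1) ≤ q * δ := by
      rw [mul_div_assoc', div_le_iff₀ (Real.exp_pos 1)]
      nlinarith [mul_pos hq hδ0]
    have h2 : (1 : ℝ) ≤ (5 / 2) ^ d := one_le_pow₀ (by norm_num)
    have h3 : (3 : ℝ) ^ d * L ≤ 2 ^ d * L * (5 / 2) ^ d := by
      rw [mul_right_comm, ← mul_pow]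
      gcongr
      norm_num
    have h4 : 2 ^ d * L * (5 / 2) ^ d ≤ q * δ * (5 / 2) ^ d := by
      have : 0 ≤ 2 ^ d * L := by positivity
      exact mul_le_mul_of_nonneg_right (by linarith) (by positivity)
    have h5 : q * δ * 1 ≤ q * δ * (5 / 2) ^ d := by gcongr
    have h6 : 0 ≤ 2 ^ d * L := by positivity
    rw [hc]
    linarith
  have hterm : ∀ k ∈ Finset.Icc 1 R, (M : ℝ) ^ ((2 * k + 1) ^ d) * (((k : ℝ) + 1) ^ d *
      (2 * Real.exp (-(2 * (q * (kappa d δ * D') / ((k : ℝ) + 1) ^ d))))) ≤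
      2 * 2 ^ d * s * Real.exp (-(c * s)) := by
    intro k hk
    rw [Finset.mem_Icc] at hk
    have hk1 : (1 : ℝ) ≤ k := by exact_mod_cast hk.1
    have hkR : (k : ℝ) ≤ R := by exact_mod_cast hk.2
    have hks : (k : ℝ) ^ d ≤ s := le_trans (by gcongr) hRd
    have hs_pos : 0 < s := lt_of_lt_of_le (by positivity) hks
    have h1 : ((k : ℝ) + 1) ^ d ≤ 2 ^ d * s := by
      calc ((k : ℝ) + 1) ^ d ≤ (2 * k) ^ d := by gcongr; linarith
        _ = 2 ^ d * k ^ d := mul_pow _ _ _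
        _ ≤ _ := by gcongr
    have h2 : (M : ℝ) ^ ((2 * k + 1) ^ d) ≤ Real.exp (3 ^ d * L * s) := by
      have hM0 : (0 : ℝ) < M := by exact_mod_cast hM
      rw [← Real.exp_log hM0, ← hL, ← Real.exp_nat_mul]
      refine Real.exp_le_exp.2 ?_
      have : (((2 * k + 1) ^ d : ℕ) : ℝ) ≤ 3 ^ d * s := by
        push_cast
        calc (2 * (k : ℝ) + 1) ^ d ≤ (3 * k) ^ d := by gcongr; linarith
          _ = 3 ^ d * k ^ d := mul_pow _ _ _
          _ ≤ _ := by gcongr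
      calc _ ≤ 3 ^ d * s * L := by gcongr
        _ = _ := by ring
    have hkap : 5 ^ d * δ ≤ kappa d δ := by
      unfold kappa
      have : 1 ≤ √(3 / 2 : ℝ) := Real.one_le_sqrt.2 (by norm_num)
      rw [mul_assoc]
      gcongr
      exact le_mul_of_one_le_left hδ0.le this
    -- The `5^d` of `kappa` is divided by the `2^d` from `(k + 1)^d ≤ 2^d √D`, and one factor `√D`
    -- of `D` is left.
    have h3 : q * δ * (5 / 2) ^ d * s ≤ q * (kappa d δ * D') / ((k : ℝ) + 1) ^ d := by
      rw [le_div_iff₀ (by positivity)]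
      calc q * δ * (5 / 2) ^ d * s * ((k : ℝ) + 1) ^ d
          ≤ q * δ * (5 / 2) ^ d * s * (2 ^ d * s) := by gcongr
        _ = q * (((5 / 2 : ℝ) * 2) ^ d * δ * (s * s)) := by rw [mul_pow]; ring
        _ = q * (5 ^ d * δ * D) := by rw [hss]; norm_num
        _ ≤ q * (kappa d δ * D') := by
          have : 0 ≤ kappa d δ := le_trans (by positivity) hkap
          gcongr
    calc _ ≤ Real.exp (3 ^ d * L * s) * (2 ^ d * s *
          (2 * Real.exp (-(2 * (q * δ * (5 / 2) ^ d * s))))) := by gcongr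
      _ = 2 * 2 ^ d * s * Real.exp ((3 ^ d * L - 2 * (q * δ * (5 / 2) ^ d)) * s) := by
        rw [show (3 ^ d * L - 2 * (q * δ * (5 / 2) ^ d)) * s =
          3 ^ d * L * s + -(2 * (q * δ * (5 / 2) ^ d * s)) by ring, Real.exp_add]
        ring
      _ ≤ 2 * 2 ^ d * s * Real.exp (-(c * s)) := by
        rw [← neg_mul]
        gcongr
  calc _ ≤ ∑ _k ∈ Finset.Icc 1 R, 2 * 2 ^ d * s * Real.exp (-(c * s)) := Finset.sum_le_sum hterm
    _ = 2 * 2 ^ d * (R * s) * Real.exp (-(c * s)) := by simp; ring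
    _ ≤ 2 * 2 ^ d * (D ^ (1 / (2 * (d : ℝ))) * s) * Real.exp (-(c * s)) := by gcongr
    _ = _ := by
      congr 2
      -- Adding exponents needs a positive base; for `D = 0` both sides vanish.
      rcases hD.eq_or_lt with h0 | h0
      · rw [hs, ← h0, Real.zero_rpow (by positivity), Real.zero_rpow (by positivity), zero_mul]
      · rw [hs, Real.sqrt_eq_rpow, ← Real.rpow_add h0]
        congr 1
        field_simp
        ring

end Overestimation

end VNRF

/-! ### The overestimation theorem. -/

theorem theorem3p1 (d : ℕ) (hd : 1 ≤ d) :
    ∃ C : ℝ, 0 < C ∧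
      ∀ (A : Type*) [Fintype A] [MeasurableSpace A] [DiscreteMeasurableSpace A]
        (Λ : ℕ → Finset (VNRF.Site d)), VNRF.IsSampling Λ →
      ∀ q δ ε : ℝ, 0 < q →
        2 ^ d * Real.log (Fintype.card A : ℝ) * (3 * Real.exp 1 / (4 * q)) < δ → 0 < ε →
      0 < VNRF.cDelta d A δ q ∧
      ∃ n₀ : ℕ,
        ∀ (γ : Finset (VNRF.Site d) → Kernel (VNRF.Config d A) (VNRF.Config d A))
          (μ : Measure (VNRF.Config d A)) [IsProbabilityMeasure μ],
          VNRF.IsVariableNeighborhood μ γ → VNRF.IsTranslationCovariant γ →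
          VNRF.qMin γ = q →
        ∀ n : ℕ, n₀ ≤ n →
          μ.real {σ | ∃ i ∈ VNRF.security (Λ n),
              VNRF.ctxLength γ i σ < (VNRF.lHat δ (Λ n) σ i : ℕ∞)} ≤
            C * Real.log ((VNRF.security (Λ n)).card : ℝ) ^ (((d : ℝ) + 1) / (2 * (d : ℝ))) *
                Real.exp (-(VNRF.cDelta d A δ q *
                  Real.sqrt (Real.log ((VNRF.security (Λ n)).card : ℝ)))) +
              C * Real.exp (-(((VNRF.security (Λ n)).card : ℝ) ^ (1 - ε))) := by
  refine ⟨2 * 2 ^ d, by positivity, ?_⟩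
  intro A _ _ _ Λ _ q δ ε hq hδ _
  have hδ0 : 0 < δ := lt_of_le_of_lt (mul_nonneg
    (mul_nonneg (by positivity) (Real.log_natCast_nonneg _)) (by positivity)) hδ
  -- The bound holds for every finite region, so `n₀ = 0` works.
  refine ⟨?_, 0, ?_⟩
  · have h := mul_lt_mul_of_pos_right hδ
      (by positivity : 0 < 2 / 3 * (2 * q / Real.exp 1))
    have h1 : 2 ^ d * Real.log (Fintype.card A : ℝ) * (3 * Real.exp 1 / (4 * q)) *
        (2 / 3 * (2 * q / Real.exp 1)) = 2 ^ d * Real.log (Fintype.card A : ℝ) := by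
      field_simp
      norm_num
    rw [h1] at h
    rw [VNRF.cDelta, sub_pos]
    refine h.trans_eq ?_
    ring
  · intro γ μ _ hμ hc hqm n _
    have hA : 1 ≤ Fintype.card A := by
      obtain ⟨ω⟩ := nonempty_of_isProbabilityMeasure μ
      exact Fintype.card_pos_iff.2 ⟨ω 0⟩
    have hlog : Real.log ((VNRF.security (Λ n)).card : ℝ) ≤ Real.log ((Λ n).card : ℝ) := by
      -- An empty security region is covered by the convention `log 0 = 0`.
      rcases Nat.eq_zero_or_pos (VNRF.security (Λ n)).card with h | h
      · rw [h, Nat.cast_zero, Real.log_zero]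
        exact Real.log_natCast_nonneg _
      · refine Real.log_le_log (by exact_mod_cast h) ?_
        classical
        exact_mod_cast Finset.card_le_card (Finset.filter_subset _ _)
    have h1 := VNRF.measureReal_overestimation_le hμ hc (hqm ▸ hq) hδ0.le (Λ n)
    rw [hqm] at h1
    have h2 := VNRF.sum_union_bound_le hd hA rfl rfl (Real.log_natCast_nonneg _) hlog hq hδ
    -- The first term alone bounds the probability; the second is only added as a nonnegative
    -- quantity.
    exact (h1.trans h2).trans (le_add_of_nonneg_right (by positivity))
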